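/- Let $(M,g)$ be a time-oriented Lorentzian manifold: $M$ is a smooth, Hausdorff, paracompact, finite-dimensional manifold and $g$ is a smooth metric on $M$ of signature $(-,+,\dots,+)$. Write $x\ll y$ if there is a future directed piecewise smooth timelike curve from $x$ to $y$, and put $I^+(x)=\{y\in M: x\ll y\}$ and $I^-(x)=\{y\in M: y\ll x\}$. A future directed sequence converging to $x$ is a sequence $x_0\ll x_1\ll x_2\ll\cdots$ with $x_i\ll x$ for all $i$ and $x_i\to x$; a past directed sequence converging to $x$ is a sequence $(y_i)$ with $y_{i+1}\ll y_i$ and $x\ll y_i$ for all $i$ and $y_i\to x$. For $x\in M$ define $$Miss^+(x)=\operatorname{Int}\Bigl(\bigcap_{i} I^+(x_i)\setminus I^+(x)\Bigr),\qquad Miss^-(x)=\operatorname{Int}\Bigl(\bigcap_{i} I^-(y_i)\setminus I^-(x)\Bigr),$$ where $(x_i)$ is any future directed and $(y_i)$ any past directed sequence converging to $x$; these sets do not depend on the choice of the sequences. $M$ is distinguishing if for all $x,y\in M$ each of $I^+(x)=I^+(y)$ and $I^-(x)=I^-(y)$ implies $x=y$. The set-valued function $I^{\pm}$ is outer continuous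 if for every $x\in M$ and every compact $K\subset M\setminus\overline{I^{\pm}(x)}$ there is a neighbourhood $U$ of $x$ such that $K\subset M\setminus\overline{I^{\pm}(y)}$ for all $y\in U$. $M$ is causally continuous if it is distinguishing and both $I^+$ and $I^-$ are outer continuous. **Theorem.** Suppose that $(M,g)$ is distinguishing. Then $M$ is causally continuous if and only if $Miss^+(x)=\varnothing=Miss^-(x)$ for all $x\in M$. -/

import Mathlib

open Set Filter Bundle
open scoped Manifold ContDiff Topology

/-- A smooth Lorentzian metric, of signature `(-, +, …, +)`, on a smooth manifold `M` without
boundary modelled on the real vector space `E`: a smooth field of symmetric bilinear forms on the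
tangent spaces. The signature is expressed by the existence, in every tangent space, of a vector
`v` with `g(v, v) < 0` such that `g` is positive definite on the `g`-orthogonal complement
of `v`. -/
structure LorentzianMetric (E : Type*) [NormedAddCommGroup E] [NormedSpace ℝ E]
    (M : Type*) [TopologicalSpace M] [ChartedSpace E M] [IsManifold 𝓘(ℝ, E) ∞ M] where
  /-- The bilinear form on each tangent space. -/
  val (x : M) : TangentSpace 𝓘(ℝ, E) x →L[ℝ] TangentSpace 𝓘(ℝ, E) x →L[ℝ] ℝ
  symm (x : M) (v w : TangentSpace 𝓘(ℝ, E) x) : val x v w = val x w v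
  signature (x : M) : ∃ v : TangentSpace 𝓘(ℝ, E) x, val x v v < 0 ∧
    ∀ w : TangentSpace 𝓘(ℝ, E) x, val x v w = 0 → w ≠ 0 → 0 < val x w w
  contMDiff : ContMDiff 𝓘(ℝ, E) (𝓘(ℝ, E).prod 𝓘(ℝ, E →L[ℝ] E →L[ℝ] ℝ)) ∞
    (fun x ↦ TotalSpace.mk' (E →L[ℝ] E →L[ℝ] ℝ)
      (E := fun x : M ↦ TangentSpace 𝓘(ℝ, E) x →L[ℝ] TangentSpace 𝓘(ℝ, E) x →L[ℝ] ℝ) x (val x))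

namespace LorentzianMetric

section

variable {E : Type*} [NormedAddCommGroup E] [NormedSpace ℝ E]
  {M : Type*} [TopologicalSpace M] [ChartedSpace E M] [IsManifold 𝓘(ℝ, E) ∞ M]

/-- A time orientation of a Lorentzian manifold: a continuous timelike vector field. -/
structure TimeOrientation (g : LorentzianMetric E M) where
  /-- The vector field; its values are the reference future directed vectors. -/
  field (x : M) : TangentSpace 𝓘(ℝ, E) x
  continuous : Continuous (fun x ↦ (⟨x, field x⟩ : TangentBundle 𝓘(ℝ, E) M))
  timelike (x : M) : g.val x (field x) (field x) < 0

namespace TimeOrientation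

variable {g : LorentzianMetric E M} (T : g.TimeOrientation)

/-- A tangent vector `v` at `x` is future directed timelike if `g(v, v) < 0` and `v` lies in the
same half of the timelike cone as the time orientation. -/
def IsFutureTimelike (x : M) (v : TangentSpace 𝓘(ℝ, E) x) : Prop :=
  g.val x v v < 0 ∧ g.val x (T.field x) v < 0

/-- There is a smooth future directed timelike curve, on a compact interval of positive length,
from `x` to `y`. The velocity at an end point of the interval is the one-sided one. -/
def SmoothlyPrecedes (x y : M) : Prop :=
  ∃ (γ : ℝ → M) (a b : ℝ), a < b ∧ γ a = x ∧ γ b = y ∧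
    ContMDiffOn 𝓘(ℝ, ℝ) 𝓘(ℝ, E) ∞ γ (Icc a b) ∧
    ∀ t ∈ Icc a b, T.IsFutureTimelike (γ t)
      (mfderivWithin 𝓘(ℝ, ℝ) 𝓘(ℝ, E) γ (Icc a b) t (1 : ℝ))

/-- The chronological relation `x ≪ y`: there is a piecewise smooth future directed timelike
curve from `x` to `y`, that is, a chain of finitely many (at least one) smooth future directed
timelike curves, each starting where the previous one ends, which leads from `x` to `y`. -/
def Precedes (x y : M) : Prop := Relation.TransGen T.SmoothlyPrecedes x y

/-- The chronological future `I⁺(x)`. -/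
def future (x : M) : Set M := {y | T.Precedes x y}

/-- The chronological past `I⁻(x)`. -/
def past (x : M) : Set M := {y | T.Precedes y x}

/-- `M` is distinguishing: `x` is determined by `I⁺(x)` alone, and also by `I⁻(x)` alone. -/
def Distinguishing : Prop :=
  ∀ x y : M, T.future x = T.future y ∨ T.past x = T.past y → x = y

/-- A set-valued function `F` on `M` is outer continuous if for every `x` and every compact set `K`
disjoint from the closure of `F x`, the set `K` is disjoint from the closure of `F y` for all `y`
in some neighbourhood of `x`. -/
def OuterContinuous (F : M → Set M) : Prop :=
  ∀ x : M, ∀ K : Set M, IsCompact K → K ⊆ (closure (F x))ᶜ →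
    ∃ U ∈ 𝓝 x, ∀ y ∈ U, K ⊆ (closure (F y))ᶜ

/-- `M` is causally continuous: it is distinguishing, and `I⁺` and `I⁻` are outer continuous. -/
def CausallyContinuous : Prop :=
  T.Distinguishing ∧ OuterContinuous T.future ∧ OuterContinuous T.past

/-- `s` is a future directed sequence converging to `x`: `s 0 ≪ s 1 ≪ ⋯ ≪ x` and `s i → x`. -/
def IsFutureSeqTo (s : ℕ → M) (x : M) : Prop :=
  (∀ i, T.Precedes (s i) (s (i + 1))) ∧ (∀ i, T.Precedes (s i) x) ∧ Tendsto s atTop (𝓝 x)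

/-- `s` is a past directed sequence converging to `x`: `x ≪ ⋯ ≪ s 1 ≪ s 0` and `s i → x`. -/
def IsPastSeqTo (s : ℕ → M) (x : M) : Prop :=
  (∀ i, T.Precedes (s (i + 1)) (s i)) ∧ (∀ i, T.Precedes x (s i)) ∧ Tendsto s atTop (𝓝 x)

/-- `Miss⁺(x)`: the interior of `(⋂ i, I⁺(s i)) \ I⁺(x)`, where `s` is a future directed sequence
converging to `x`. This set is the same for all such `s` (every `I⁺(y)` is open, so the
intersection does not depend on `s`); the union over all `s` avoids choosing one. -/
def missFuture (x : M) : Set M :=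
  ⋃ (s : ℕ → M) (_ : T.IsFutureSeqTo s x), interior ((⋂ i, T.future (s i)) \ T.future x)

/-- `Miss⁻(x)`: the interior of `(⋂ i, I⁻(s i)) \ I⁻(x)`, where `s` is a past directed sequence
converging to `x`; as for `missFuture`, this does not depend on `s`. -/
def missPast (x : M) : Set M :=
  ⋃ (s : ℕ → M) (_ : T.IsPastSeqTo s x), interior ((⋂ i, T.past (s i)) \ T.past x)

end TimeOrientation

end

end LorentzianMetric

/-! Distinction is assumed, so it remains to see that each of `I⁺`, `I⁻` is outer continuous exactly
when its Miss sets are empty. Beyond transitivity, only two facts about `≪` matter: `I^±(x)` is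
open, and `x` is a limit of points of `I^±(x)` (`isOpen_future`, `exists_timelike_curve_through`).
If outer continuity fails near `x`, some `k` outside the closure of `I⁺(x)` lies in the closure of
every `I⁺(x_i)`. Any `w` with `k ≪ w` has `I⁻(w)` as a neighbourhood of `k`, hence `x_i ≪ w` for all
`i`; so the part of `I⁺(k)` off the closure of `I⁺(x)` is a nonempty open set inside `Miss⁺(x)`.
Conversely, a point of `Miss⁺(x)` is itself a compact set violating outer continuity. The past case
is the same argument for the reversed relation. -/

namespace LorentzianMetric

variable {E : Type*} [NormedAddCommGroup E] [NormedSpace ℝ E]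
  {M : Type*} [TopologicalSpace M] [ChartedSpace E M] [IsManifold 𝓘(ℝ, E) ∞ M]

/-! ### Timelike segments in charts -/

/-- A Lorentzian metric is continuous along continuous maps into the tangent bundle. -/
theorem continuous_val_comp (g : LorentzianMetric E M) {X : Type*} [TopologicalSpace X] {b : X → M}
    {v w : ∀ p, TangentSpace 𝓘(ℝ, E) (b p)}
    (hv : Continuous fun p ↦ (⟨b p, v p⟩ : TangentBundle 𝓘(ℝ, E) M))
    (hw : Continuous fun p ↦ (⟨b p, w p⟩ : TangentBundle 𝓘(ℝ, E) M)) :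
    Continuous fun p ↦ g.val (b p) (v p) (w p) := by
  have hb : Continuous b := (FiberBundle.continuous_proj E (TangentSpace 𝓘(ℝ, E))).comp hv
  have := Continuous.clm_bundle_apply₂ (F₁ := E) (F₂ := E) (F₃ := ℝ)
    (E₃ := fun _ : M ↦ ℝ) (b := b) (ψ := fun p ↦ g.val (b p))
    (g.contMDiff.continuous.comp hb) hv hw
  simpa using (Trivial.homeomorphProd M ℝ).continuous.comp this |>.snd

namespace TimeOrientation

variable {g : LorentzianMetric E M} (T : g.TimeOrientation)

theorem isOpen_setOf_isFutureTimelike :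
    IsOpen {p : TangentBundle 𝓘(ℝ, E) M | T.IsFutureTimelike p.1 p.2} := by
  have hid : Continuous fun p : TangentBundle 𝓘(ℝ, E) M ↦
      (⟨p.1, p.2⟩ : TangentBundle 𝓘(ℝ, E) M) := continuous_id
  have hT : Continuous fun p : TangentBundle 𝓘(ℝ, E) M ↦
      (⟨p.1, T.field p.1⟩ : TangentBundle 𝓘(ℝ, E) M) :=
    T.continuous.comp (FiberBundle.continuous_proj E (TangentSpace 𝓘(ℝ, E)))
  exact (isOpen_Iio.preimage (g.continuous_val_comp hid hid)).inter
    (isOpen_Iio.preimage (g.continuous_val_comp hT hid))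

/-- The future directed timelike vectors, in the coordinates of the chart at `x`. -/
def chartCone (x : M) : Set (E × E) :=
  {p | T.IsFutureTimelike ((extChartAt 𝓘(ℝ, E) x).symm p.1)
    (mfderivWithin 𝓘(ℝ, E) 𝓘(ℝ, E) (extChartAt 𝓘(ℝ, E) x).symm (extChartAt 𝓘(ℝ, E) x).target
      p.1 p.2)}

theorem chartCone_mem_nhds {x : M} {p : E × E} (hp : p.1 ∈ (extChartAt 𝓘(ℝ, E) x).target)
    (h : p ∈ T.chartCone x) : T.chartCone x ∈ 𝓝 p := by
  have ho := isOpen_extChartAt_target (I := 𝓘(ℝ, E)) x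
  have hc := (contMDiffOn_extChartAt_symm (I := 𝓘(ℝ, E)) (n := ∞) x).continuousOn_tangentMapWithin
    (by norm_num) ho.uniqueMDiffOn
  have hj : Continuous fun p : E × E ↦ (⟨p.1, p.2⟩ : TangentBundle 𝓘(ℝ, E) E) :=
    (tangentBundleModelSpaceHomeomorph 𝓘(ℝ, E)).symm.continuous
  have := (hc.comp hj.continuousOn (s := Prod.fst ⁻¹' (extChartAt 𝓘(ℝ, E) x).target)
    (fun q hq ↦ hq)).continuousAt ((ho.preimage continuous_fst).mem_nhds hp)
  exact this.preimage_mem_nhds (T.isOpen_setOf_isFutureTimelike.mem_nhds h)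

theorem smoothlyPrecedes_of_line {x : M} {e u : E} {h : ℝ} (hh : 0 < h)
    (ht : ∀ t ∈ Icc 0 h, e + t • u ∈ (extChartAt 𝓘(ℝ, E) x).target)
    (hc : ∀ t ∈ Icc 0 h, (e + t • u, u) ∈ T.chartCone x) :
    T.SmoothlyPrecedes ((extChartAt 𝓘(ℝ, E) x).symm e)
      ((extChartAt 𝓘(ℝ, E) x).symm (e + h • u)) := by
  have hl : ContMDiff 𝓘(ℝ, ℝ) 𝓘(ℝ, E) ∞ fun t : ℝ ↦ e + t • u :=
    (contDiff_const.add (contDiff_id.smul contDiff_const)).contMDiff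
  have hs := contMDiffOn_extChartAt_symm (I := 𝓘(ℝ, E)) (n := ∞) x
  refine ⟨fun t ↦ (extChartAt 𝓘(ℝ, E) x).symm (e + t • u), 0, h, hh, by simp, rfl,
    hs.comp hl.contMDiffOn ht, fun t htt ↦ ?_⟩
  have hd : HasMFDerivWithinAt 𝓘(ℝ, ℝ) 𝓘(ℝ, E) (fun t : ℝ ↦ e + t • u) (Icc 0 h) t
      (ContinuousLinearMap.toSpanSingleton ℝ u) := by
    have : HasDerivAt (fun t : ℝ ↦ e + t • u) u t := by
      simpa using ((hasDerivAt_id t).smul_const u).const_add e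
    exact this.hasFDerivAt.hasFDerivWithinAt.hasMFDerivWithinAt
  have h1 := ((hs.mdifferentiableOn (by simp)) _ (ht t htt)).hasMFDerivWithinAt
  have h2 := (HasMFDerivWithinAt.comp t h1 hd ht).mfderivWithin
    ((uniqueDiffOn_Icc hh).uniqueMDiffOn t htt)
  change T.IsFutureTimelike _ (mfderivWithin 𝓘(ℝ, ℝ) 𝓘(ℝ, E)
    ((extChartAt 𝓘(ℝ, E) x).symm ∘ fun t : ℝ ↦ e + t • u) (Icc 0 h) t (1 : ℝ))
  rw [h2]
  have key : ∀ w : E, w = u → (e + t • u, w) ∈ T.chartCone x := by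
    intro w hw
    rw [hw]
    exact hc t htt
  exact key _ (one_smul ℝ u)

/-- The cone is open, so near `(e₀, u₀)` every straight segment is timelike; balls are convex, so it
stays in the region. The free parameter `h` rescales the displacement: only its direction has to be
close to `u₀`. -/
theorem exists_ball_smoothlyPrecedes {x : M} {e₀ u₀ : E}
    (he : e₀ ∈ (extChartAt 𝓘(ℝ, E) x).target) (h : (e₀, u₀) ∈ T.chartCone x) :
    ∃ r > 0, ∀ e ∈ Metric.ball e₀ r, ∀ e' ∈ Metric.ball e₀ r, ∀ h > (0 : ℝ),
      h⁻¹ • (e' - e) ∈ Metric.ball u₀ r →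
      T.SmoothlyPrecedes ((extChartAt 𝓘(ℝ, E) x).symm e) ((extChartAt 𝓘(ℝ, E) x).symm e') := by
  have hn : T.chartCone x ∩ Prod.fst ⁻¹' (extChartAt 𝓘(ℝ, E) x).target ∈ 𝓝 (e₀, u₀) :=
    inter_mem (T.chartCone_mem_nhds he h)
      (((isOpen_extChartAt_target (I := 𝓘(ℝ, E)) x).preimage continuous_fst).mem_nhds he)
  obtain ⟨r, hr, hsub⟩ := Metric.mem_nhds_iff.1 hn
  refine ⟨r, hr, fun e hE e' hE' h hh hu ↦ ?_⟩
  have key : ∀ t ∈ Icc 0 h, (e + t • h⁻¹ • (e' - e), h⁻¹ • (e' - e)) ∈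
      T.chartCone x ∩ Prod.fst ⁻¹' (extChartAt 𝓘(ℝ, E) x).target := fun t ht ↦ by
    refine hsub ?_
    rw [← ball_prod_same]
    refine ⟨?_, hu⟩
    have := (convex_ball e₀ r).add_smul_sub_mem hE hE' (t := t * h⁻¹)
      ⟨by have := ht.1; positivity, by rw [← div_eq_mul_inv, div_le_one hh]; exact ht.2⟩
    rwa [mul_smul] at this
  have := T.smoothlyPrecedes_of_line hh (fun t ht ↦ (key t ht).2) (fun t ht ↦ (key t ht).1)
  rwa [smul_inv_smul₀ hh.ne', add_sub_cancel] at this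

theorem mem_chartCone_of_isFutureTimelike {x : M} {v : TangentSpace 𝓘(ℝ, E) x}
    (hv : T.IsFutureTimelike x v) :
    (extChartAt 𝓘(ℝ, E) x x, (mfderiv 𝓘(ℝ, E) 𝓘(ℝ, E) (extChartAt 𝓘(ℝ, E) x) x v : E)) ∈
      T.chartCone x := by
  have h := mfderivWithin_extChartAt_symm_comp_mfderiv_extChartAt' (I := 𝓘(ℝ, E))
    (mem_extChartAt_source (I := 𝓘(ℝ, E)) x)
  rw [ModelWithCorners.range_eq_univ, mfderivWithin_univ,
    ← mfderivWithin_of_isOpen (isOpen_extChartAt_target (I := 𝓘(ℝ, E)) x)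
      (mem_extChartAt_target x)] at h
  have key : ∀ (y : M) (w : E), y = x → w = v → T.IsFutureTimelike y w := by
    rintro _ _ rfl rfl
    exact hv
  exact key _ _ (extChartAt_to_inv x) (DFunLike.congr_fun h v)

theorem smoothlyPrecedes_of_subinterval {γ : ℝ → M} {a b c d : ℝ}
    (hγ : ContMDiffOn 𝓘(ℝ, ℝ) 𝓘(ℝ, E) ∞ γ (Icc a b))
    (ht : ∀ t ∈ Icc a b, T.IsFutureTimelike (γ t)
      (mfderivWithin 𝓘(ℝ, ℝ) 𝓘(ℝ, E) γ (Icc a b) t (1 : ℝ)))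
    (hcd : c < d) (hsub : Icc c d ⊆ Icc a b) : T.SmoothlyPrecedes (γ c) (γ d) := by
  refine ⟨γ, c, d, hcd, rfl, rfl, hγ.mono hsub, fun t htt ↦ ?_⟩
  rw [mfderivWithin_subset hsub ((uniqueDiffOn_Icc hcd).uniqueMDiffOn t htt)
    (hγ.mdifferentiableOn (by simp) t (hsub htt))]
  exact ht t (hsub htt)

/-- The coordinate representation of a curve in the chart at one of its points is differentiable
there, with derivative the coordinate representation of the velocity. -/
theorem hasDerivWithinAt_extChartAt_comp {γ : ℝ → M} {s : Set ℝ} {t : ℝ}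
    (hγ : MDifferentiableWithinAt 𝓘(ℝ, ℝ) 𝓘(ℝ, E) γ s t) :
    HasDerivWithinAt (fun t' ↦ extChartAt 𝓘(ℝ, E) (γ t) (γ t'))
      (mfderiv 𝓘(ℝ, E) 𝓘(ℝ, E) (extChartAt 𝓘(ℝ, E) (γ t)) (γ t)
        (mfderivWithin 𝓘(ℝ, ℝ) 𝓘(ℝ, E) γ s t (1 : ℝ)) : E) s t := by
  have h1 : HasMFDerivAt 𝓘(ℝ, E) 𝓘(ℝ, E) (extChartAt 𝓘(ℝ, E) (γ t)) (γ t) _ :=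
    (mdifferentiableAt_extChartAt (I := 𝓘(ℝ, E)) (mem_chart_source E (γ t))).hasMFDerivAt
  have h2 := h1.comp_hasMFDerivWithinAt t hγ.hasMFDerivWithinAt
  obtain ⟨L, hL⟩ : ∃ L : ℝ →L[ℝ] E, L = (mfderiv 𝓘(ℝ, E) 𝓘(ℝ, E) (extChartAt 𝓘(ℝ, E) (γ t))
    (γ t)).comp (mfderivWithin 𝓘(ℝ, ℝ) 𝓘(ℝ, E) γ s t) := ⟨_, rfl⟩
  have h3 : HasFDerivWithinAt (extChartAt 𝓘(ℝ, E) (γ t) ∘ γ) L s t :=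
    hL ▸ hasMFDerivWithinAt_iff_hasFDerivWithinAt.1 h2
  have h4 := h3.hasDerivWithinAt
  rw [hL] at h4
  exact h4

variable {T} in
-- Just before its end, the curve has a chord to the end point that is almost parallel to the final
-- velocity. Fixing the start `q` of such a chord, small changes of the end keep the direction
-- timelike, so straight segments reach all nearby points.
theorem SmoothlyPrecedes.exists_left {x y : M} (h : T.SmoothlyPrecedes x y) :
    ∃ q, T.SmoothlyPrecedes x q ∧ ∀ᶠ y' in 𝓝 y, T.SmoothlyPrecedes q y' := by
  obtain ⟨γ, a, b, hab, rfl, rfl, hγ, ht⟩ := h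
  have hb : b ∈ Icc a b := right_mem_Icc.2 hab.le
  have hd := hasDerivWithinAt_extChartAt_comp (hγ.mdifferentiableOn (by simp) b hb)
  obtain ⟨r, hr, hball⟩ := T.exists_ball_smoothlyPrecedes (mem_extChartAt_target (γ b))
    (T.mem_chartCone_of_isFutureTimelike (ht b hb))
  set φ := extChartAt 𝓘(ℝ, E) (γ b)
  have hle : 𝓝[Ioo a b] b ≤ 𝓝[Icc a b] b := nhdsWithin_mono _ Ioo_subset_Icc_self
  have hsrc : ∀ᶠ y' in 𝓝 (γ b), y' ∈ φ.source := extChartAt_source_mem_nhds (I := 𝓘(ℝ, E)) (γ b)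
  have hcφ : ContinuousAt φ (γ b) := continuousAt_extChartAt (γ b)
  have e1 : ∀ᶠ t in 𝓝[Ioo a b] b, γ t ∈ φ.source :=
    hle ((hγ.continuousOn b hb).eventually hsrc)
  have e2 : ∀ᶠ t in 𝓝[Ioo a b] b, φ (γ t) ∈ Metric.ball (φ (γ b)) r :=
    hle (hd.continuousWithinAt.eventually (Metric.ball_mem_nhds _ hr))
  have e3 := (hasDerivWithinAt_iff_tendsto_slope.1 hd).eventually (Metric.ball_mem_nhds _ hr)
  have hsub : Ioo a b ⊆ Icc a b \ {b} := fun t ht ↦ ⟨Ioo_subset_Icc_self ht, ht.2.ne⟩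
  replace e3 := nhdsWithin_mono b hsub e3
  have : (𝓝[Ioo a b] b).NeBot := right_nhdsWithin_Ioo_neBot hab
  obtain ⟨t, h1, h2, h3, htab⟩ :=
    (e1.and (e2.and (Eventually.and e3 self_mem_nhdsWithin))).exists
  refine ⟨γ t, T.smoothlyPrecedes_of_subinterval hγ ht htab.1 (Icc_subset_Icc_right htab.2.le), ?_⟩
  have hcont : ContinuousAt (fun y' ↦ (b - t)⁻¹ • (φ y' - φ (γ t))) (γ b) :=
    (hcφ.sub continuousAt_const).const_smul _
  -- Symmetry of the slope orients the chord from the earlier time `t` to `b`, so that its time step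
  -- `b - t` is positive.
  rw [slope_comm, slope_def_module] at h3
  filter_upwards [hsrc, hcφ.eventually (Metric.ball_mem_nhds _ hr),
    hcont.eventually (Metric.isOpen_ball.mem_nhds h3)] with y' g1 g2 g3
  have := hball _ h2 _ g2 (b - t) (sub_pos.2 htab.2) g3
  rwa [φ.left_inv h1, φ.left_inv g1] at this

variable {T} in
theorem SmoothlyPrecedes.exists_right {x y : M} (h : T.SmoothlyPrecedes x y) :
    ∃ q, T.SmoothlyPrecedes q y ∧ ∀ᶠ x' in 𝓝 x, T.SmoothlyPrecedes x' q := by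
  obtain ⟨γ, a, b, hab, rfl, rfl, hγ, ht⟩ := h
  have ha : a ∈ Icc a b := left_mem_Icc.2 hab.le
  have hd := hasDerivWithinAt_extChartAt_comp (hγ.mdifferentiableOn (by simp) a ha)
  obtain ⟨r, hr, hball⟩ := T.exists_ball_smoothlyPrecedes (mem_extChartAt_target (γ a))
    (T.mem_chartCone_of_isFutureTimelike (ht a ha))
  set φ := extChartAt 𝓘(ℝ, E) (γ a)
  have hle : 𝓝[Ioo a b] a ≤ 𝓝[Icc a b] a := nhdsWithin_mono _ Ioo_subset_Icc_self
  have hsrc : ∀ᶠ y' in 𝓝 (γ a), y' ∈ φ.source := extChartAt_source_mem_nhds (I := 𝓘(ℝ, E)) (γ a)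
  have hcφ : ContinuousAt φ (γ a) := continuousAt_extChartAt (γ a)
  have e1 : ∀ᶠ t in 𝓝[Ioo a b] a, γ t ∈ φ.source :=
    hle ((hγ.continuousOn a ha).eventually hsrc)
  have e2 : ∀ᶠ t in 𝓝[Ioo a b] a, φ (γ t) ∈ Metric.ball (φ (γ a)) r :=
    hle (hd.continuousWithinAt.eventually (Metric.ball_mem_nhds _ hr))
  have e3 := (hasDerivWithinAt_iff_tendsto_slope.1 hd).eventually (Metric.ball_mem_nhds _ hr)
  have hsub : Ioo a b ⊆ Icc a b \ {a} := fun t ht ↦ ⟨Ioo_subset_Icc_self ht, ht.1.ne'⟩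
  replace e3 := nhdsWithin_mono a hsub e3
  have : (𝓝[Ioo a b] a).NeBot := left_nhdsWithin_Ioo_neBot hab
  obtain ⟨t, h1, h2, h3, htab⟩ :=
    (e1.and (e2.and (Eventually.and e3 self_mem_nhdsWithin))).exists
  refine ⟨γ t, T.smoothlyPrecedes_of_subinterval hγ ht htab.2 (Icc_subset_Icc_left htab.1.le), ?_⟩
  have hcont : ContinuousAt (fun x' ↦ (t - a)⁻¹ • (φ (γ t) - φ x')) (γ a) :=
    (continuousAt_const.sub hcφ).const_smul _
  rw [slope_def_module] at h3
  filter_upwards [hsrc, hcφ.eventually (Metric.ball_mem_nhds _ hr),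
    hcont.eventually (Metric.isOpen_ball.mem_nhds h3)] with x' g1 g2 g3
  have := hball _ g2 _ h2 (t - a) (sub_pos.2 htab.1) g3
  rwa [φ.left_inv h1, φ.left_inv g1] at this

/-! ### Openness of futures and pasts, and approximating sequences -/

theorem isOpen_future (x : M) : IsOpen (T.future x) := by
  refine isOpen_iff_mem_nhds.2 fun y hy ↦ ?_
  obtain ⟨z, hxz, hzy⟩ := Relation.TransGen.tail'_iff.1 hy
  obtain ⟨q, hzq, hq⟩ := hzy.exists_left
  filter_upwards [hq] with y' hy'
  exact (Relation.TransGen.tail' hxz hzq).tail hy'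

theorem isOpen_past (x : M) : IsOpen (T.past x) := by
  refine isOpen_iff_mem_nhds.2 fun y hy ↦ ?_
  obtain ⟨z, hyz, hzx⟩ := Relation.TransGen.head'_iff.1 hy
  obtain ⟨q, hqz, hq⟩ := hyz.exists_right
  filter_upwards [hq] with y' hy'
  exact Relation.TransGen.head hy' (Relation.TransGen.head' hqz hzx)

/-- A short timelike curve through a given point. -/
theorem exists_timelike_curve_through (x : M) : ∃ (c : ℝ → M) (δ : ℝ), 0 < δ ∧ c 0 = x ∧
    Tendsto c (𝓝 0) (𝓝 x) ∧
    ∀ s t, -δ < s → s < t → t < δ → T.Precedes (c s) (c t) := by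
  have hv : T.IsFutureTimelike x (T.field x) := ⟨T.timelike x, T.timelike x⟩
  have hx := mem_extChartAt_target (I := 𝓘(ℝ, E)) x
  obtain ⟨r, hr, hball⟩ :=
    T.exists_ball_smoothlyPrecedes hx (T.mem_chartCone_of_isFutureTimelike hv)
  set φ := extChartAt 𝓘(ℝ, E) x with hφ
  set u : E := mfderiv 𝓘(ℝ, E) 𝓘(ℝ, E) φ x (T.field x)
  have hl : Continuous fun t : ℝ ↦ φ x + t • u := by fun_prop
  have hl0 : φ x + (0 : ℝ) • u = φ x := by simp
  have hball0 : ∀ᶠ t : ℝ in 𝓝 0, φ x + t • u ∈ Metric.ball (φ x) r := by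
    refine hl.continuousAt.eventually ?_
    simp only [hl0]
    exact Metric.ball_mem_nhds _ hr
  obtain ⟨δ, hδ, hsub⟩ := Metric.eventually_nhds_iff.1 hball0
  refine ⟨fun t ↦ φ.symm (φ x + t • u), δ, hδ, by simp [hφ], ?_, fun s t hs hst ht ↦ ?_⟩
  · have h1 : ContinuousAt φ.symm (φ x + (0 : ℝ) • u) := by
      rw [hl0]
      exact continuousAt_extChartAt_symm x
    have h2 := (h1.comp (f := fun t : ℝ ↦ φ x + t • u) hl.continuousAt).tendsto
    simpa [Function.comp_def, hφ] using h2
  -- The curve is a chart line of velocity `u`, so with time step `t - s` the rescaled displacement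
  -- is exactly `u`, the centre of the ball.
  · refine .single (hball _ (hsub ?_) _ (hsub ?_) (t - s) (sub_pos.2 hst) ?_)
    · rw [dist_zero_right, Real.norm_eq_abs, abs_lt]
      exact ⟨hs, hst.trans ht⟩
    · rw [dist_zero_right, Real.norm_eq_abs, abs_lt]
      exact ⟨hs.trans hst, ht⟩
    · rw [add_sub_add_left_eq_sub, ← sub_smul, inv_smul_smul₀ (sub_pos.2 hst).ne']
      exact Metric.mem_ball_self hr

theorem exists_isFutureSeqTo (x : M) : ∃ s, T.IsFutureSeqTo s x := by
  obtain ⟨c, δ, hδ, rfl, hc, hprec⟩ := T.exists_timelike_curve_through x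
  obtain ⟨a, ha, haδ, hlim⟩ := exists_seq_strictMono_tendsto' (neg_lt_zero.2 hδ)
  exact ⟨c ∘ a, fun i ↦ hprec _ _ (haδ i).1 (ha i.lt_succ_self) ((haδ _).2.trans hδ),
    fun i ↦ hprec _ _ (haδ i).1 (haδ i).2 hδ, hc.comp hlim⟩

theorem exists_isPastSeqTo (x : M) : ∃ s, T.IsPastSeqTo s x := by
  obtain ⟨c, δ, hδ, rfl, hc, hprec⟩ := T.exists_timelike_curve_through x
  obtain ⟨a, ha, haδ, hlim⟩ := exists_seq_strictAnti_tendsto' hδ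
  have hn := neg_lt_zero.2 hδ
  exact ⟨c ∘ a, fun i ↦ hprec _ _ (hn.trans (haδ _).1) (ha i.lt_succ_self) (haδ i).2,
    fun i ↦ hprec _ _ hn (haδ i).1 (haδ i).2, hc.comp hlim⟩

theorem mem_closure_future (x : M) : x ∈ closure (T.future x) := by
  obtain ⟨s, -, h, hs⟩ := T.exists_isPastSeqTo x
  exact mem_closure_of_tendsto hs (.of_forall h)

theorem mem_closure_past (x : M) : x ∈ closure (T.past x) := by
  obtain ⟨s, -, h, hs⟩ := T.exists_isFutureSeqTo x
  exact mem_closure_of_tendsto hs (.of_forall h)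

end TimeOrientation
end LorentzianMetric

namespace LorentzianMetric
namespace TimeOrientation

/-! ### Outer continuity for open transitive relations -/

section OpenRelation

variable {X : Type*} [TopologicalSpace X] {R : X → X → Prop}

/-- For an open transitive relation `R` such that every point is a limit of its `R`-successors,
outer continuity follows if no open set lies in the limit of the sets of `R`-successors along a
sequence of `R`-predecessors of `x`, but outside the set of `R`-successors of `x`. -/
theorem outerContinuous_of_interior_eq_empty (hR : ∀ {x y z}, R x y → R y z → R x z)
    (hF : ∀ x, IsOpen {y | R x y}) (hP : ∀ x, IsOpen {y | R y x})
    (hcl : ∀ x, x ∈ closure {y | R x y})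
    (hmiss : ∀ x, ∃ s : ℕ → X, (∀ i, R (s i) x) ∧
      interior ((⋂ i, {y | R (s i) y}) \ {y | R x y}) = ∅) :
    OuterContinuous fun x ↦ {y | R x y} := by
  intro x K hK hKx
  obtain ⟨s, hs, hint⟩ := hmiss x
  have hmono : ∀ {y z}, R y z → {w | R z w} ⊆ {w | R y w} := fun h _ hw ↦ hR h hw
  have key : ∀ k ∈ K, ∃ i, k ∉ closure {y | R (s i) y} := by
    intro k hk
    by_contra! hall
    have hopen : IsOpen ((closure {y | R x y})ᶜ ∩ {w | R k w}) :=
      isClosed_closure.isOpen_compl.inter (hF k)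
    have hsub : (closure {y | R x y})ᶜ ∩ {w | R k w} ⊆ (⋂ i, {y | R (s i) y}) \ {y | R x y} := by
      refine fun w hw ↦ ⟨mem_iInter.2 fun i ↦ ?_, fun h ↦ hw.1 (subset_closure h)⟩
      obtain ⟨v, hvw, hv⟩ := mem_closure_iff.1 (hall i) _ (hP w) hw.2
      exact hR hv hvw
    obtain ⟨w, hw⟩ := mem_closure_iff.1 (hcl k) _ isClosed_closure.isOpen_compl (hKx hk)
    exact (hint ▸ interior_maximal hsub hopen hw : w ∈ (∅ : Set X))
  -- Compactness reduces the claim to a neighbourhood of one point `k`. There the successors of `s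
  -- i` serve as the neighbourhood of `x`, since each such `y` has its successors among those of `s
  -- i`.
  refine hK.induction_on (p := fun S ↦ ∃ U ∈ 𝓝 x, ∀ y ∈ U, S ⊆ (closure {z | R y z})ᶜ)
    ⟨univ, univ_mem, fun _ _ ↦ empty_subset _⟩
    (fun S S' hSS' ⟨U, hU, h⟩ ↦ ⟨U, hU, fun y hy ↦ hSS'.trans (h y hy)⟩)
    (fun S S' ⟨U, hU, h⟩ ⟨U', hU', h'⟩ ↦ ⟨U ∩ U', inter_mem hU hU', fun y hy ↦
      union_subset (h y hy.1) (h' y hy.2)⟩) fun k hk ↦ ?_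
  obtain ⟨i, hi⟩ := key k hk
  exact ⟨_, mem_nhdsWithin_of_mem_nhds (isClosed_closure.isOpen_compl.mem_nhds hi),
    _, (hF (s i)).mem_nhds (hs i),
    fun y hy ↦ compl_subset_compl.2 (closure_mono (hmono hy))⟩

/-- An interior point cannot lie in the closure of `F x`, so outer continuity for that single point
excludes it from `F (s i)` for some `i`. -/
theorem OuterContinuous.interior_eq_empty {F : X → Set X} (hF : OuterContinuous F) {x : X}
    {s : ℕ → X} (hs : Tendsto s atTop (𝓝 x)) : interior ((⋂ i, F (s i)) \ F x) = ∅ := by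
  refine eq_empty_of_forall_notMem fun y hy ↦ ?_
  have hyx : y ∉ closure (F x) := fun h ↦ by
    obtain ⟨z, hz, hzx⟩ := mem_closure_iff.1 h _ isOpen_interior hy
    exact (interior_subset hz).2 hzx
  obtain ⟨U, hU, hd⟩ := hF x {y} isCompact_singleton (singleton_subset_iff.2 hyx)
  obtain ⟨i, hi⟩ := (hs.eventually hU).exists
  exact hd _ hi rfl (subset_closure (mem_iInter.1 (interior_subset hy).1 i))

end OpenRelation

variable {E : Type*} [NormedAddCommGroup E] [NormedSpace ℝ E]
  {M : Type*} [TopologicalSpace M] [ChartedSpace E M] [IsManifold 𝓘(ℝ, E) ∞ M]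
  {g : LorentzianMetric E M} (T : g.TimeOrientation)

theorem outerContinuous_future_iff :
    OuterContinuous T.future ↔ ∀ x, T.missFuture x = ∅ := by
  simp only [missFuture, iUnion_eq_empty]
  refine ⟨fun h x s hs ↦ h.interior_eq_empty hs.2.2, fun h ↦ ?_⟩
  refine outerContinuous_of_interior_eq_empty (R := T.Precedes) Relation.TransGen.trans
    T.isOpen_future T.isOpen_past T.mem_closure_future fun x ↦ ?_
  obtain ⟨s, hs⟩ := T.exists_isFutureSeqTo x
  exact ⟨s, hs.2.1, h x s hs⟩

theorem outerContinuous_past_iff :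
    OuterContinuous T.past ↔ ∀ x, T.missPast x = ∅ := by
  simp only [missPast, iUnion_eq_empty]
  refine ⟨fun h x s hs ↦ h.interior_eq_empty hs.2.2, fun h ↦ ?_⟩
  refine outerContinuous_of_interior_eq_empty (R := fun x y ↦ T.Precedes y x)
    (fun h h' ↦ Relation.TransGen.trans h' h)
    T.isOpen_past T.isOpen_future T.mem_closure_past fun x ↦ ?_
  obtain ⟨s, hs⟩ := T.exists_isPastSeqTo x
  exact ⟨s, hs.2.1, h x s hs⟩

end TimeOrientation
end LorentzianMetric

theorem mainTheorem12 {E : Type*} [NormedAddCommGroup E] [NormedSpace ℝ E] [FiniteDimensional ℝ E]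
    {M : Type*} [TopologicalSpace M] [T2Space M] [ParacompactSpace M]
    [ChartedSpace E M] [IsManifold 𝓘(ℝ, E) ∞ M]
    (g : LorentzianMetric E M) (T : g.TimeOrientation) (hM : T.Distinguishing) :
    T.CausallyContinuous ↔ ∀ x : M, T.missFuture x = ∅ ∧ T.missPast x = ∅ := by
  rw [forall_and, ← T.outerContinuous_future_iff, ← T.outerContinuous_past_iff]
  exact and_iff_right hM
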